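/- All graphs are finite, undirected and simple. For graphs $H,G$ and $r\in\mathbb N$, $H$ is a \emph{depth-$r$ minor} of $G$ if there are pairwise vertex-disjoint nonempty connected subgraphs $(I_u)_{u\in V(H)}$ of $G$, each of radius at most $r$, such that whenever $uv\in E(H)$ there is an edge of $G$ between $V(I_u)$ and $V(I_v)$. A class $\mathcal C$ of graphs is \emph{nowhere dense} if there is a function $t\colon\mathbb N\to\mathbb N$ such that for every $r\in\mathbb N$ no $G\in\mathcal C$ has the clique $K_{t(r)}$ as a depth-$r$ minor. It has \emph{bounded expansion} if there is a function $d\colon\mathbb N\to\mathbb N$ such that $|E(H)|/|V(H)|\le d(r)$ for every $r\in\mathbb N$ and every depth-$r$ minor $H$ (with at least one vertex) of a graph in $\mathcal C$; otherwise it has \emph{unbounded expansion}. For a first-order formula $\varphi(x,y)$ in the language of graphs (adjacency and equality) with one object variable $x$ and one parameter variable $y$, a graph $G$ and $A\subseteq V(G)$, let $$S^{\varphi}(G/A)=\bigl\{\{v\in A : G\models\varphi(u,v)\} : u\in V(G)\bigr\}.$$ \textbf{Theorem.} Let $\mathcal C$ be a class of graphs closed under taking (not necessarily induced) subgraphs.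 \begin{enumerate} \item If $\mathcal C$ is not nowhere dense, then there is a first-order formula $\varphi(x,y)$ such that for every $n\in\mathbb N$ there are $G\in\mathcal C$ and $A\subseteq V(G)$ with $|A|=n$ and $|S^{\varphi}(G/A)|=2^{|A|}$. \item If $\mathcal C$ has unbounded expansion, then there is a first-order formula $\varphi(x,y)$ such that for every $c\in\mathbb R$ there are $G\in\mathcal C$ and a nonempty $A\subseteq V(G)$ with $|S^{\varphi}(G/A)|>c\,|A|$. \end{enumerate} -/

import Mathlib

open FirstOrder

universe u v w

namespace SparseGraphs

/-- A finite simple graph, with its vertex type bundled. -/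
structure FiniteGraph : Type (u + 1) where
  /-- the vertex type -/
  V : Type u
  /-- there are finitely many vertices -/
  finite : Finite V
  /-- the graph itself -/
  graph : SimpleGraph V

/-- A subgraph of a finite graph, regarded as a finite graph in its own right. -/
def FiniteGraph.ofSubgraph (G : FiniteGraph.{u}) (H : G.graph.Subgraph) : FiniteGraph.{u} where
  V := H.verts
  finite := haveI := G.finite; inferInstance
  graph := H.coe

/-- A class of finite graphs is closed under taking subgraphs (not necessarily induced). -/
def SubgraphClosed (C : Set FiniteGraph.{u}) : Prop :=
  ∀ G ∈ C, ∀ H : G.graph.Subgraph, G.ofSubgraph H ∈ C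

/-- `I` is a minor model of `H` in `G`: the branch sets `I a` are pairwise vertex-disjoint connected
(in particular nonempty) subgraphs of `G`, and every edge of `H` is witnessed by an edge of `G`
between the corresponding branch sets. -/
structure IsMinorModel {W : Type v} {V : Type w} (H : SimpleGraph W) (G : SimpleGraph V)
    (I : W → G.Subgraph) : Prop where
  connected : ∀ a, (I a).Connected
  disjoint : ∀ a b, a ≠ b → Disjoint (I a).verts (I b).verts
  adj : ∀ a b, H.Adj a b → ∃ x ∈ (I a).verts, ∃ y ∈ (I b).verts, G.Adj x y

/-- `H` is a depth-`r` minor of `G`: it has a minor model in `G` whose branch sets have radius at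
most `r`, the radius of a branch set being computed inside that branch set. -/
def IsDepthMinor {W : Type v} {V : Type w} (r : ℕ) (H : SimpleGraph W) (G : SimpleGraph V) :
    Prop :=
  ∃ I : W → G.Subgraph, IsMinorModel H G I ∧ ∀ a, (I a).coe.radius ≤ (r : ℕ∞)

/-- The class `C` is nowhere dense. -/
def NowhereDense (C : Set FiniteGraph.{u}) : Prop :=
  ∃ t : ℕ → ℕ, ∀ r : ℕ, ∀ G ∈ C, ¬ IsDepthMinor r (⊤ : SimpleGraph (Fin (t r))) G.graph

/-- The edge density `|E(H)| / |V(H)|` of a finite graph (`0` for the graph without vertices). -/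
noncomputable def FiniteGraph.edgeDensity (H : FiniteGraph.{u}) : ℝ :=
  (H.graph.edgeSet.ncard : ℝ) / (Nat.card H.V : ℝ)

/-- The class `C` has bounded expansion. -/
def BoundedExpansion (C : Set FiniteGraph.{u}) : Prop :=
  ∃ d : ℕ → ℕ, ∀ r : ℕ, ∀ G ∈ C, ∀ H : FiniteGraph.{u},
    IsDepthMinor r H.graph G.graph → H.edgeDensity ≤ (d r : ℝ)

/-- The set `S^φ(G/A)` of `φ`-types over `A` realized in `G`. The free variables of the first-order
formula `φ` are split into object variables, indexed by `α`, and parameter variables, indexed by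
`β`. Each tuple `x` of vertices of `G` contributes the set of those tuples `y` of elements of `A`
for which `φ(x, y)` holds in `G`. -/
def typeSet {α : Type v} {β : Type w} (φ : Language.graph.Formula (α ⊕ β)) {V : Type u}
    (G : SimpleGraph V) (A : Set V) : Set (Set (β → A)) :=
  letI := G.structure
  Set.range fun x : α → V => {y : β → A | φ.Realize (Sum.elim x fun j => (y j : V))}

end SparseGraphs

/-! A depth-`r` minor has branch sets with centres and depths, and each edge of `H` is coloured by
the depths of the two ends of a witnessing edge. For edges of one colour `(s, i)` between disjoint
index sets `B` and `A`, keeping only suitable edges of `G` gives a layered graph in which a walk of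
length exactly `s + 1 + i` joins two centres iff the chosen relation `F` holds
(`hasWalk_layered_iff`). Subgraph-closure keeps this graph in `C`, and having such a walk is
first-order, so any monochromatic bipartite part of a shallow minor can be encoded.

For cliques, pigeonhole gives a monochromatic product on which `F` is set membership, so all subsets
are realized. For dense minors, `exists_monochromatic_distinct_neighborhoods` gives a small `A` and
a large `B` with distinct selected neighbourhoods in `A`. There are finitely many colours, so one
formula serves all sizes. -/

namespace SparseGraphs

/-! ### First-order definability of walks -/

/-- There is a walk of length `k` from `x` to `y` in `G`. -/
def HasWalk {V : Type*} (G : SimpleGraph V) : ℕ → V → V → Prop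
  | 0, x, y => x = y
  | k + 1, x, y => ∃ z, G.Adj x z ∧ HasWalk G k z y

/-- The formula expressing that there is a walk of length `k` from the variable `a` to the free
variable `y`. -/
def walkBoundedFormula {α : Type*} (y : α) :
    ℕ → (n : ℕ) → α ⊕ Fin n → Language.graph.BoundedFormula α n
  | 0, _, a => (Language.Term.var a).bdEqual (Language.Term.var (Sum.inl y))
  | k + 1, n, a =>
    ((Language.adj.boundedFormula₂ (Language.Term.var (Sum.map id Fin.castSucc a))
      (Language.Term.var (Sum.inr (Fin.last n)))) ⊓
      walkBoundedFormula y k (n + 1) (Sum.inr (Fin.last n))).ex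

theorem realize_walkBoundedFormula {α V : Type*} (G : SimpleGraph V) (y : α) (v : α → V)
    (k n : ℕ) (a : α ⊕ Fin n) (xs : Fin n → V) :
    letI := G.structure
    (walkBoundedFormula y k n a).Realize v xs ↔ HasWalk G k (Sum.elim v xs a) (v y) := by
  let := G.structure
  induction k generalizing n with
  | zero => simp [walkBoundedFormula, HasWalk]
  | succ k ih =>
    simp only [walkBoundedFormula, HasWalk, Language.BoundedFormula.realize_ex,
      Language.BoundedFormula.realize_inf, ih, Language.BoundedFormula.realize_rel₂]
    refine exists_congr fun z => ?_
    have hz : Sum.elim v (Fin.snoc xs z : Fin (n + 1) → V) (Sum.inr (Fin.last n)) = z := by simp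
    have ha : Sum.elim v (Fin.snoc xs z : Fin (n + 1) → V) (Sum.map id Fin.castSucc a) =
        Sum.elim v xs a := by
      cases a <;> simp
    rw [hz]
    refine and_congr_left fun _ => ?_
    change G.Adj _ _ ↔ _
    simp [ha]

/-- The formula expressing that there is a walk of length `k` between its two free variables. -/
def walkFormula (k : ℕ) : Language.graph.Formula (Fin 1 ⊕ Fin 1) :=
  walkBoundedFormula (Sum.inr 0) k 0 (Sum.inl (Sum.inl 0))

theorem realize_walkFormula {V : Type*} (G : SimpleGraph V) (k : ℕ) (v : Fin 1 ⊕ Fin 1 → V) :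
    letI := G.structure
    (walkFormula k).Realize v ↔ HasWalk G k (v (Sum.inl 0)) (v (Sum.inr 0)) :=
  realize_walkBoundedFormula G _ v k 0 _ _

theorem typeSet_walkFormula {V : Type*} (G : SimpleGraph V) (k : ℕ) (A : Set V) :
    typeSet (walkFormula k) G A =
      Set.range fun x : V => {y : Fin 1 → A | HasWalk G k x (y 0)} := by
  ext T
  simp only [typeSet, realize_walkFormula, Set.mem_range, Sum.elim_inl, Sum.elim_inr]
  exact ⟨fun ⟨x, hx⟩ => ⟨x 0, hx⟩, fun ⟨x, hx⟩ => ⟨fun _ => x, hx⟩⟩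

theorem HasWalk.iso_iff {V V' : Type*} {G : SimpleGraph V} {G' : SimpleGraph V'} (e : G ≃g G')
    (k : ℕ) (x y : V) : HasWalk G' k (e x) (e y) ↔ HasWalk G k x y := by
  induction k generalizing x with
  | zero => exact e.injective.eq_iff
  | succ k ih =>
    refine (e.toEquiv.exists_congr fun z => ?_).symm
    exact and_congr e.map_adj_iff.symm (ih z).symm

/-- Deleting edges of a member of a subgraph-closed class does not leave the class. -/
theorem SubgraphClosed.exists_iso_of_le {C : Set FiniteGraph.{u}} (hC : SubgraphClosed C)
    {G : FiniteGraph.{u}} (hG : G ∈ C) {K : SimpleGraph G.V} (hK : K ≤ G.graph) :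
    ∃ G' ∈ C, Nonempty (K ≃g G'.graph) :=
  ⟨_, hC G hG (SimpleGraph.toSubgraph K hK), ⟨⟨(Equiv.Set.univ G.V).symm, Iff.rfl⟩⟩⟩

/-! ### Shallow minors as centres and depths -/

theorem exists_depth_of_radius_le {V : Type*} {G : SimpleGraph V} {I : G.Subgraph}
    (hI : I.Connected) {r : ℕ} (hr : I.coe.radius ≤ (r : ℕ∞)) :
    ∃ c ∈ I.verts, ∃ f : V → ℕ, f c = 0 ∧ ∀ x ∈ I.verts, f x ≤ r ∧ (f x = 0 → x = c) ∧
      ∀ k, f x = k + 1 → ∃ y ∈ I.verts, G.Adj y x ∧ f y = k := by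
  classical
  have hconn : I.coe.Connected := hI.coe
  have : Nonempty I.verts := hconn.nonempty
  obtain ⟨c, hc⟩ := I.coe.exists_eccent_eq_radius
  refine ⟨c, c.2, fun x => if h : x ∈ I.verts then I.coe.dist c ⟨x, h⟩ else 0, by simp,
    fun x hx => ?_⟩
  simp only [hx, dite_true]
  refine ⟨?_, fun h0 => ?_, fun k hk => ?_⟩
  · have h1 : ((I.coe.dist c ⟨x, hx⟩ : ℕ) : ℕ∞) ≤ r := by
      rw [(hconn.preconnected _ _).coe_dist_eq_edist]
      exact SimpleGraph.edist_le_eccent.trans (hc.le.trans hr)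
    exact_mod_cast h1
  · rw [hconn.dist_eq_zero_iff] at h0
    rw [h0]
  · obtain ⟨p, hp⟩ := hconn.exists_walk_length_eq_dist ⟨x, hx⟩ c
    rw [SimpleGraph.dist_comm, hk] at hp
    cases p with
    | nil => simp at hp
    | @cons _ y _ hadj q =>
      refine ⟨y, y.2, (I.coe_adj_sub _ _ hadj).symm, ?_⟩
      simp only [Subtype.coe_prop, dite_true, Subtype.coe_eta]
      simp only [SimpleGraph.Walk.length_cons, add_left_inj] at hp
      apply le_antisymm
      · rw [SimpleGraph.dist_comm, ← hp]
        exact SimpleGraph.dist_le q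
      · have h1 := hconn.dist_triangle (u := c) (v := y) (w := ⟨x, hx⟩)
        rw [SimpleGraph.dist_eq_one_iff_adj.2 hadj.symm, hk] at h1
        omega

/-- A minor model of depth `r`, presented by its branch sets, their centres, and the distance of a
vertex to the centre of its branch set. -/
structure BranchSystem {W : Type v} {V : Type w} (r : ℕ) (H : SimpleGraph W) (G : SimpleGraph V)
    where
  /-- the branch sets -/
  S : W → Set V
  /-- the centres -/
  c : W → V
  /-- the distance to the centre -/
  d : V → ℕ
  eq_of_mem : ∀ {a b x}, x ∈ S a → x ∈ S b → a = b
  c_mem : ∀ a, c a ∈ S a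
  d_c : ∀ a, d (c a) = 0
  d_le : ∀ {a x}, x ∈ S a → d x ≤ r
  eq_c : ∀ {a x}, x ∈ S a → d x = 0 → x = c a
  exists_parent : ∀ {a x k}, x ∈ S a → d x = k + 1 → ∃ y ∈ S a, G.Adj y x ∧ d y = k
  adj : ∀ {a b}, H.Adj a b → ∃ x ∈ S a, ∃ y ∈ S b, G.Adj x y

/-- Disjointness of the branch sets lets their distance functions be glued into a single `d`. -/
theorem IsDepthMinor.nonempty_branchSystem {W : Type v} {V : Type w} {r : ℕ} {H : SimpleGraph W}
    {G : SimpleGraph V} (h : IsDepthMinor r H G) : Nonempty (BranchSystem r H G) := by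
  classical
  obtain ⟨I, hI, hr⟩ := h
  choose c hc f hfc hf using fun a => exists_depth_of_radius_le (hI.connected a) (hr a)
  have huniq : ∀ {a b x}, x ∈ (I a).verts → x ∈ (I b).verts → a = b := by
    intro a b x hxa hxb
    by_contra hab
    exact Set.disjoint_left.1 (hI.disjoint a b hab) hxa hxb
  obtain ⟨d, hd⟩ : ∃ d : V → ℕ, ∀ a, ∀ x ∈ (I a).verts, d x = f a x := by
    refine ⟨fun x => if h : ∃ a, x ∈ (I a).verts then f h.choose x else 0, fun a x hx => ?_⟩
    have h : ∃ a, x ∈ (I a).verts := ⟨a, hx⟩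
    simp only [h, dite_true]
    rw [huniq h.choose_spec hx]
  refine ⟨⟨fun a => (I a).verts, c, d, huniq, hc, fun a => ?_, fun {a x} hx => ?_,
    fun {a x} hx h0 => ?_, fun {a x k} hx hk => ?_, fun {a b} hab => hI.adj a b hab⟩⟩
  · rw [hd a _ (hc a), hfc]
  · rw [hd a x hx]
    exact (hf a x hx).1
  · rw [hd a x hx] at h0
    exact (hf a x hx).2.1 h0
  · rw [hd a x hx] at hk
    obtain ⟨y, hy, hyx, hyk⟩ := (hf a x hx).2.2 k hk
    exact ⟨y, hy, hyx, by rw [hd a y hy, hyk]⟩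

namespace BranchSystem

variable {W : Type v} {V : Type w} {r : ℕ} {H : SimpleGraph W} {G : SimpleGraph V}

theorem c_injective (T : BranchSystem r H G) : Function.Injective T.c := fun a b hab =>
  T.eq_of_mem (T.c_mem a) (hab ▸ T.c_mem b)

/-- Every edge of `H` is witnessed by an edge of `G` whose ends have some depths at most `r`. -/
theorem exists_color (T : BranchSystem r H G) :
    ∃ col : W → W → Fin (r + 1) × Fin (r + 1), ∀ a b, H.Adj a b →
      ∃ x ∈ T.S a, ∃ y ∈ T.S b, G.Adj x y ∧ T.d x = (col a b).1 ∧ T.d y = (col a b).2 := by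
  have h : ∀ a b, ∃ p : Fin (r + 1) × Fin (r + 1), H.Adj a b →
      ∃ x ∈ T.S a, ∃ y ∈ T.S b, G.Adj x y ∧ T.d x = p.1 ∧ T.d y = p.2 := by
    intro a b
    by_cases hab : H.Adj a b
    · obtain ⟨x, hx, y, hy, hxy⟩ := T.adj hab
      exact ⟨⟨⟨T.d x, Nat.lt_succ_of_le (T.d_le hx)⟩, ⟨T.d y, Nat.lt_succ_of_le (T.d_le hy)⟩⟩,
        fun _ => ⟨x, hx, y, hy, hxy, rfl, rfl⟩⟩
    · exact ⟨default, fun h => absurd h hab⟩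
  choose col hcol using h
  exact ⟨col, hcol⟩

/-! ### Encoding a relation in a layered subgraph -/

/-- The arcs of the layered subgraph of `G` leading from the centres of the branch sets in `B` away
to depth `s`, from there along the pairs in `F` to vertices of depth `i`, and on to the centres of
the branch sets in `A`. -/
def Arc (T : BranchSystem r H G) (s i : ℕ) (A B : Set W) (F : W → W → Prop) (x y : V) : Prop :=
  G.Adj x y ∧ ((∃ b ∈ B, x ∈ T.S b ∧ y ∈ T.S b ∧ T.d y = T.d x + 1) ∨
    (∃ a ∈ A, x ∈ T.S a ∧ y ∈ T.S a ∧ T.d x = T.d y + 1) ∨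
    (∃ b a, F b a ∧ x ∈ T.S b ∧ y ∈ T.S a ∧ T.d x = s ∧ T.d y = i))

/-- The layered subgraph of `G` formed by the arcs. -/
def layered (T : BranchSystem r H G) (s i : ℕ) (A B : Set W) (F : W → W → Prop) :
    SimpleGraph V where
  Adj x y := T.Arc s i A B F x y ∨ T.Arc s i A B F y x
  symm := ⟨fun _ _ h => h.symm⟩
  loopless := ⟨fun _ h => h.elim (fun h => h.1.ne rfl) fun h => h.1.ne rfl⟩

theorem layered_le (T : BranchSystem r H G) (s i : ℕ) (A B : Set W) (F : W → W → Prop) :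
    T.layered s i A B F ≤ G := fun _ _ h => h.elim (fun h => h.1) fun h => h.1.symm

variable {s i : ℕ} {A B : Set W} {F : W → W → Prop}

theorem hasWalk_layered_of_mem_right (T : BranchSystem r H G) {a : W} (ha : a ∈ A) (k : ℕ) (x : V)
    (hx : x ∈ T.S a) (hk : T.d x = k) : HasWalk (T.layered s i A B F) k x (T.c a) := by
  induction k generalizing x with
  | zero => exact T.eq_c hx hk
  | succ k ih =>
    obtain ⟨y, hy, hyx, hyk⟩ := T.exists_parent hx hk
    exact ⟨y, Or.inl ⟨hyx.symm, Or.inr (Or.inl ⟨a, ha, hx, hy, by omega⟩)⟩, ih y hy hyk⟩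

theorem hasWalk_layered_of_mem_left (T : BranchSystem r H G) {b : W} (hb : b ∈ B) (k m : ℕ)
    (x z : V) (hx : x ∈ T.S b) (hk : T.d x = k) (h : HasWalk (T.layered s i A B F) m x z) :
    HasWalk (T.layered s i A B F) (k + m) (T.c b) z := by
  induction k generalizing x m with
  | zero => rwa [← T.eq_c hx hk, zero_add]
  | succ k ih =>
    obtain ⟨y, hy, hyx, hyk⟩ := T.exists_parent hx hk
    have := ih (m + 1) y hy hyk
      ⟨x, Or.inl ⟨hyx, Or.inl ⟨b, hb, hy, hx, by omega⟩⟩, h⟩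
    rwa [show k + 1 + m = k + (m + 1) by omega]

/-- In the layered subgraph, walks of length `s + 1 + i` between centres encode the relation `F`. -/
theorem hasWalk_layered_iff (T : BranchSystem r H G) (hAB : Disjoint A B)
    (hF : ∀ b a, F b a → b ∈ B ∧ a ∈ A ∧
      ∃ x ∈ T.S b, ∃ y ∈ T.S a, G.Adj x y ∧ T.d x = s ∧ T.d y = i)
    {b a : W} (hb : b ∈ B) (ha : a ∈ A) :
    HasWalk (T.layered s i A B F) (s + 1 + i) (T.c b) (T.c a) ↔ F b a := by
  classical
  have hne : ∀ {b a x}, b ∈ B → a ∈ A → x ∈ T.S b → x ∉ T.S a := by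
    intro b a x hb ha hxb hxa
    rw [T.eq_of_mem hxb hxa] at hb
    exact Set.disjoint_left.1 hAB ha hb
  constructor
  -- A level function that rises by exactly 1 along every arc. It takes values in `ℤ` because depths
  -- in `A`-sets may exceed `s + 1 + i`.
  · obtain ⟨lam, hB, hA⟩ : ∃ lam : V → ℤ, (∀ b ∈ B, ∀ x ∈ T.S b, lam x = T.d x) ∧
        ∀ a ∈ A, ∀ x ∈ T.S a, lam x = s + 1 + i - T.d x := by
      refine ⟨fun x => if ∃ b ∈ B, x ∈ T.S b then (T.d x : ℤ) else s + 1 + i - T.d x,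
        fun b hb x hx => if_pos ⟨b, hb, hx⟩, fun a ha x hx => if_neg ?_⟩
      rintro ⟨b, hb, hxb⟩
      exact hne hb ha hxb hx
    have hArc : ∀ x y, T.Arc s i A B F x y → lam y = lam x + 1 := by
      rintro x y ⟨-, ⟨b, hb, hx, hy, h⟩ | ⟨a, ha, hx, hy, h⟩ | ⟨b, a, h, hx, hy, h1, h2⟩⟩
      · rw [hB b hb x hx, hB b hb y hy, h]
        push_cast
        ring
      · rw [hA a ha x hx, hA a ha y hy, h]
        push_cast
        ring
      · rw [hB b (hF b a h).1 x hx, hA a (hF b a h).2.1 y hy, h1, h2]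
        ring
    have hlow : ∀ k z, HasWalk (T.layered s i A B F) k z (T.c a) → lam (T.c a) - k ≤ lam z := by
      intro k
      induction k with
      | zero =>
        rintro z rfl
        simp
      | succ k ih =>
        rintro z ⟨y, hzy, hy⟩
        have h1 := ih y hy
        push_cast
        rcases hzy with h | h
        · linarith [hArc _ _ h]
        · linarith [hArc _ _ h]
    -- A walk as long as its rise in level uses every arc forwards. Traced back from `T.c a`, it
    -- stays in `T.S a` until it crosses one `F`-pair, and then stays in that `T.S b`.
    have hmem : ∀ k z, HasWalk (T.layered s i A B F) k z (T.c a) → lam (T.c a) - k = lam z →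
        z ∈ T.S a ∨ ∃ b, F b a ∧ z ∈ T.S b := by
      intro k
      induction k with
      | zero =>
        rintro z rfl -
        exact Or.inl (T.c_mem a)
      | succ k ih =>
        rintro z ⟨y, hzy, hy⟩ hz
        push_cast at hz
        have hzy : T.Arc s i A B F z y := by
          refine hzy.resolve_right fun h => ?_
          linarith [hArc _ _ h, hlow k y hy]
        have hy' := ih y hy (by linarith [hArc _ _ hzy])
        obtain ⟨-, ⟨b', hb', hz', hyb'⟩ | ⟨a', ha', hz', hya', -⟩ |
          ⟨b', a', h, hz', hya', -, -⟩⟩ := hzy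
        · rcases hy' with hy' | ⟨b'', hb'', hy'⟩
          · exact absurd hy' (hne hb' ha hyb'.1)
          · exact Or.inr ⟨b'', hb'', T.eq_of_mem hyb'.1 hy' ▸ hz'⟩
        · rcases hy' with hy' | ⟨b'', hb'', hy'⟩
          · exact Or.inl (T.eq_of_mem hya' hy' ▸ hz')
          · exact absurd hya' (hne (hF _ _ hb'').1 ha' hy')
        · rcases hy' with hy' | ⟨b'', hb'', hy'⟩
          · exact Or.inr ⟨b', T.eq_of_mem hya' hy' ▸ h, hz'⟩
          · exact absurd hya' (hne (hF _ _ hb'').1 (hF _ _ h).2.1 hy')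
    intro h
    rcases hmem _ _ h (by
      rw [hA a ha _ (T.c_mem a), hB b hb _ (T.c_mem b), T.d_c, T.d_c]
      push_cast
      ring) with h | ⟨b', h, hb'⟩
    · exact absurd h (hne hb ha (T.c_mem b))
    · exact T.eq_of_mem hb' (T.c_mem b) ▸ h
  · intro h
    obtain ⟨-, -, x, hx, y, hy, hxy, hs, hi⟩ := hF b a h
    rw [add_assoc]
    refine T.hasWalk_layered_of_mem_left hb s (1 + i) x _ hx hs ?_
    rw [add_comm 1 i]
    exact ⟨y, Or.inl ⟨hxy, Or.inr (Or.inr ⟨b, a, h, hx, hy, hs, hi⟩)⟩,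
      T.hasWalk_layered_of_mem_right ha i y hy hi⟩

end BranchSystem

/-! ### Monochromatic products -/

/-- A finite colouring of the pairs of a large set is constant on a product of an `n`-element set
with a disjoint `2 ^ n`-element set. -/
theorem exists_monochromatic_product (κ : Type*) [Finite κ] [Nonempty κ] (n : ℕ) :
    ∃ t : ℕ, ∀ col : Fin t → Fin t → κ, ∃ q : κ, ∃ f : Fin n → Fin t, ∃ g : Set (Fin n) → Fin t,
      f.Injective ∧ g.Injective ∧ (∀ j S, f j ≠ g S) ∧ ∀ j S, col (g S) (f j) = q := by
  classical
  have := Fintype.ofFinite κ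
  -- Two pigeonholes: `2 ^ n` of the `M` rows coincide with some `h`, and `h` is constant on `n` of
  -- the `m` columns.
  set m := Fintype.card κ * n with hm
  set M := Fintype.card (Fin m → κ) * 2 ^ n with hM
  refine ⟨m + M, fun col => ?_⟩
  obtain ⟨h, hh⟩ := Fintype.exists_le_card_fiber_of_mul_le_card (n := 2 ^ n)
    (fun (b : Fin M) (a : Fin m) => col (Fin.natAdd m b) (Fin.castAdd M a))
    (by rw [Fintype.card_fin])
  obtain ⟨q, hq⟩ := Fintype.exists_le_card_fiber_of_mul_le_card (n := n) h
    (by rw [Fintype.card_fin])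
  obtain ⟨g⟩ : Nonempty (Set (Fin n) ↪ {b : Fin M //
      (fun a : Fin m => col (Fin.natAdd m b) (Fin.castAdd M a)) = h}) := by
    apply Function.Embedding.nonempty_of_card_le
    rw [Fintype.card_set, Fintype.card_fin, Fintype.card_subtype]
    exact hh
  obtain ⟨f⟩ : Nonempty (Fin n ↪ {a : Fin m // h a = q}) := by
    apply Function.Embedding.nonempty_of_card_le
    rw [Fintype.card_fin, Fintype.card_subtype]
    exact hq
  refine ⟨q, fun j => Fin.castAdd M (f j).1, fun S => Fin.natAdd m (g S).1, ?_, ?_, ?_, ?_⟩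
  · intro j j' hj
    exact f.injective (Subtype.ext (Fin.castAdd_injective _ _ hj))
  · intro S S' hS
    exact g.injective (Subtype.ext (Fin.natAdd_injective _ _ hS))
  · intro j S h
    have h1 := congrArg Fin.val h
    simp only [Fin.val_castAdd, Fin.val_natAdd] at h1
    have := (f j).1.isLt
    omega
  · intro j S
    exact (congrFun (g S).2 (f j).1).trans (f j).2

/-! ### Distinct neighbourhoods in dense graphs -/

section Density

variable {W : Type*} (H : SimpleGraph W)

open scoped Classical in
/-- A graph of large average degree has a nonempty set of vertices inducing a subgraph of large
minimum degree. -/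
theorem exists_subset_forall_le_degree (D : ℕ) (U : Finset W)
    (hU : 2 * D * U.card < ∑ u ∈ U, (U.filter (H.Adj u)).card) :
    ∃ U' : Finset W, U'.Nonempty ∧ ∀ u ∈ U', D ≤ (U'.filter (H.Adj u)).card := by
  induction U using Finset.strongInduction with
  | H U ih =>
    by_cases h : ∀ u ∈ U, D ≤ (U.filter (H.Adj u)).card
    · refine ⟨U, Finset.nonempty_iff_ne_empty.2 ?_, h⟩
      rintro rfl
      simp at hU
    · push Not at h
      obtain ⟨v, hv, hvD⟩ := h
      refine ih (U.erase v) (Finset.erase_ssubset hv) ?_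
      have h1 : ∀ u ∈ U.erase v, (U.filter (H.Adj u)).card =
          ((U.erase v).filter (H.Adj u)).card + if H.Adj v u then 1 else 0 := by
        intro u _
        rw [Finset.filter_erase]
        by_cases huv : H.Adj v u
        · have hmem : v ∈ U.filter (H.Adj u) := Finset.mem_filter.2 ⟨hv, huv.symm⟩
          rw [if_pos huv, Finset.card_erase_add_one hmem]
        · rw [if_neg huv, Finset.erase_eq_of_notMem, add_zero]
          exact fun hmem => huv (Finset.mem_filter.1 hmem).2.symm
      have h2 : ∑ u ∈ U.erase v, (if H.Adj v u then 1 else 0) ≤ (U.filter (H.Adj v)).card := by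
        rw [← Finset.card_filter]
        exact Finset.card_le_card (Finset.filter_subset_filter _ (Finset.erase_subset _ _))
      have h3 := Finset.add_sum_erase U (fun u => (U.filter (H.Adj u)).card) hv
      rw [Finset.sum_congr rfl h1, Finset.sum_add_distrib] at h3
      have h4 := Finset.card_erase_add_one hv
      rw [← h4, mul_add, mul_one] at hU
      omega

open scoped Classical in
/-- In a graph of large minimum degree there is a small set `A` such that many vertices outside of
`A` have many neighbours in `A`. -/
theorem exists_small_set_many_neighbors (k c : ℕ) (hk : 0 < k) (U : Finset W) (hU : U.Nonempty)
    (hdeg : ∀ u ∈ U, 4 * k * (c + 1) + k ≤ (U.filter (H.Adj u)).card) :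
    ∃ A B : Finset W, A.Nonempty ∧ Disjoint A B ∧ c * A.card ≤ B.card ∧
      ∀ b ∈ B, k ≤ (A.filter (H.Adj b)).card := by
  set t := 2 * k * (c + 1) with ht
  have htpos : 0 < t := by positivity
  -- Each vertex of `A` costs `t`, and each `u` earns at most `k`. A maximizer is small, and no
  -- further vertex has more than `t` unsaturated neighbours.
  let g : Finset W → ℤ := fun A => ∑ u ∈ U, (min k (A.filter (H.Adj u)).card : ℕ) - t * A.card
  obtain ⟨A, hAU, hmax⟩ := Finset.exists_max_image U.powerset g ⟨∅, by simp⟩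
  rw [Finset.mem_powerset] at hAU
  set sat := U.filter fun u => k ≤ (A.filter (H.Adj u)).card with hsat
  set uns := U.filter fun u => ¬ k ≤ (A.filter (H.Adj u)).card with huns
  have hcard : sat.card + uns.card = U.card := Finset.card_filter_add_card_filter_not _
  -- comparison with the empty set
  have hA : t * A.card ≤ k * U.card := by
    have h0 := hmax ∅ (by simp)
    have h1 : g ∅ = 0 := by simp [g]
    have h2 : ∑ u ∈ U, min k (A.filter (H.Adj u)).card ≤ U.card * k := by
      rw [← smul_eq_mul]
      exact Finset.sum_le_card_nsmul _ _ _ fun u _ => min_le_left _ _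
    rw [h1] at h0
    simp only [g] at h0
    zify at h2 ⊢
    push_cast at h0
    linarith
  -- comparison with the sets `insert w A`
  have hins : ∀ w ∈ U \ A, (uns.filter fun u => H.Adj u w).card ≤ t := by
    intro w hw
    rw [Finset.mem_sdiff] at hw
    have h0 := hmax (insert w A) (Finset.mem_powerset.2 (Finset.insert_subset hw.1 hAU))
    have h1 : ∑ u ∈ U, min k (A.filter (H.Adj u)).card + (uns.filter fun u => H.Adj u w).card ≤
        ∑ u ∈ U, min k ((insert w A).filter (H.Adj u)).card := by
      rw [huns, Finset.filter_filter, Finset.card_filter, ← Finset.sum_add_distrib]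
      refine Finset.sum_le_sum fun u _ => ?_
      rw [Finset.filter_insert]
      by_cases huw : H.Adj u w
      · rw [if_pos huw, Finset.card_insert_of_notMem
          (fun h => hw.2 (Finset.mem_filter.1 h).1)]
        split_ifs <;> omega
      · rw [if_neg huw, if_neg (fun h => huw h.2), add_zero]
    simp only [g, Finset.card_insert_of_notMem hw.2] at h0
    zify at h1 ⊢
    push_cast at h0
    linarith
  -- Double counting: an unsaturated vertex has fewer than `k` neighbours in `A`, hence at least `2
  -- * t` outside.
  have hedge : uns.card * (2 * t) ≤ U.card * t := by
    calc uns.card * (2 * t) ≤ ∑ u ∈ uns, ((U \ A).filter (H.Adj u)).card := by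
          rw [← smul_eq_mul]
          refine Finset.card_nsmul_le_sum _ _ _ fun u hu => ?_
          rw [huns, Finset.mem_filter] at hu
          have h1 := hdeg u hu.1
          have h2 : (U.filter (H.Adj u)).card ≤
              ((U \ A).filter (H.Adj u)).card + (A.filter (H.Adj u)).card := by
            refine le_trans (Finset.card_le_card ?_) (Finset.card_union_le _ _)
            intro x hx
            simp only [Finset.mem_union, Finset.mem_filter, Finset.mem_sdiff] at hx ⊢
            tauto
          have h3 : 4 * k * (c + 1) = 2 * t := by rw [ht]; ring
          omega
      _ = ∑ w ∈ U \ A, (uns.filter fun u => H.Adj u w).card :=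
          Finset.sum_card_bipartiteAbove_eq_sum_card_bipartiteBelow _
      _ ≤ (U \ A).card * t := by
          rw [← smul_eq_mul]
          exact Finset.sum_le_card_nsmul _ _ _ hins
      _ ≤ U.card * t := Nat.mul_le_mul_right _ (Finset.card_le_card Finset.sdiff_subset)
  have huns2 : 2 * uns.card ≤ U.card := by
    refine le_of_mul_le_mul_right ?_ htpos
    linarith
  have hA2 : 2 * ((c + 1) * A.card) ≤ U.card := by
    refine le_of_mul_le_mul_left ?_ hk
    calc k * (2 * ((c + 1) * A.card)) = t * A.card := by rw [ht]; ring
      _ ≤ k * U.card := hA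
  have hUpos : 0 < U.card := hU.card_pos
  refine ⟨A, sat \ A, ?_, Finset.disjoint_sdiff, ?_, fun b hb => ?_⟩
  · obtain ⟨u, hu⟩ : sat.Nonempty := Finset.card_pos.1 (by omega)
    rw [hsat, Finset.mem_filter] at hu
    obtain ⟨a, ha⟩ := Finset.card_pos.1 (hk.trans_le hu.2)
    exact ⟨a, (Finset.mem_filter.1 ha).1⟩
  · have h1 := Finset.le_card_sdiff A sat
    rw [add_mul, one_mul] at hA2
    omega
  · rw [Finset.mem_sdiff, hsat, Finset.mem_filter] at hb
    exact hb.1.2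

/-- Given a family of finite sets `T b`, one can either choose distinct subsets of all of them, or
realize all subsets of some `T b` by subsets chosen for distinct indices. -/
theorem exists_injOn_subset_or_exists_shatter {ι α : Type*} (T : ι → Finset α) (B : Finset ι) :
    (∃ N : ι → Finset α, Set.InjOn N B ∧ ∀ b ∈ B, N b ⊆ T b) ∨
      ∃ b ∈ B, ∃ B' ⊆ B, ∃ N : ι → Finset α, Set.InjOn N B' ∧
        (∀ b' ∈ B', N b' ⊆ T b' ∧ N b' ⊆ T b) ∧ 2 ^ (T b).card ≤ B'.card := by
  classical
  induction B using Finset.induction_on with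
  | empty => exact Or.inl ⟨fun _ => ∅, by simp, by simp⟩
  | insert b B hb ih =>
    rcases ih with ⟨N, hinj, hN⟩ | ⟨b₀, hb₀, B', hB', N, h⟩
    -- Greedy choice: it gets stuck at `b` only if every subset of `T b` is already taken, and then
    -- the indices taking them realize all these subsets.
    · by_cases h : (T b).powerset ⊆ B.image N
      · refine Or.inr ⟨b, Finset.mem_insert_self _ _, B.filter fun b' => N b' ⊆ T b,
          (Finset.filter_subset _ _).trans (Finset.subset_insert _ _), N,
          hinj.mono (Finset.coe_subset.2 (Finset.filter_subset _ _)), fun b' hb' => ?_, ?_⟩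
        · rw [Finset.mem_filter] at hb'
          exact ⟨hN b' hb'.1, hb'.2⟩
        · rw [← Finset.card_powerset]
          refine (Finset.card_le_card fun S hS => ?_).trans (Finset.card_image_le (f := N))
          obtain ⟨b', hb', rfl⟩ := Finset.mem_image.1 (h hS)
          exact Finset.mem_image_of_mem _
            (Finset.mem_filter.2 ⟨hb', Finset.mem_powerset.1 hS⟩)
      · obtain ⟨S, hS, hSN⟩ := Finset.not_subset.1 h
        have hne : ∀ b' ∈ B, b' ≠ b := fun b' hb' h => hb (h ▸ hb')
        have hS' : ∀ b' ∈ B, N b' ≠ S := fun b' hb' h => hSN (Finset.mem_image.2 ⟨b', hb', h⟩)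
        refine Or.inl ⟨Function.update N b S, ?_, fun b' hb' => ?_⟩
        · intro x hx y hy hxy
          rw [Finset.mem_coe, Finset.mem_insert] at hx hy
          rcases hx with rfl | hx <;> rcases hy with rfl | hy
          · rfl
          · rw [Function.update_self, Function.update_of_ne (hne y hy)] at hxy
            exact absurd hxy.symm (hS' y hy)
          · rw [Function.update_self, Function.update_of_ne (hne x hx)] at hxy
            exact absurd hxy (hS' x hx)
          · rw [Function.update_of_ne (hne x hx), Function.update_of_ne (hne y hy)] at hxy
            exact hinj hx hy hxy
        · rcases Finset.mem_insert.1 hb' with rfl | hb'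
          · rw [Function.update_self]
            exact Finset.mem_powerset.1 hS
          · rw [Function.update_of_ne (hne b' hb')]
            exact hN b' hb'
    · exact Or.inr ⟨b₀, Finset.mem_insert_of_mem hb₀, B', hB'.trans (Finset.subset_insert _ _),
        N, h⟩

theorem mul_lt_two_pow_of_add_four_le {c m : ℕ} (h : c + 4 ≤ m) : c * m < 2 ^ m := by
  have hsq : ∀ m, 4 ≤ m → m * m ≤ 2 ^ m := by
    intro m hm
    induction m, hm using Nat.le_induction with
    | base => norm_num
    | succ m hm ih =>
      rw [pow_succ]
      nlinarith
  exact (Nat.mul_lt_mul_of_pos_right (by omega) (by omega)).trans_le (hsq m (by omega))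

/-- For every finite colouring of the ordered edges of a graph of large edge density, there is a
small set `A` of vertices and a large disjoint set `B` of vertices which have distinct sets of
selected neighbours in `A`, all of them selected along edges of the same colour. -/
theorem exists_monochromatic_distinct_neighborhoods (κ : Type*) [Finite κ] [Nonempty κ] (c : ℕ) :
    ∃ D : ℕ, ∀ {W : Type u} [Finite W] (H : SimpleGraph W) (col : W → W → κ),
      D * Nat.card W < H.edgeSet.ncard → ∃ q : κ, ∃ A B : Finset W, ∃ N : W → Finset W,
        A.Nonempty ∧ Disjoint A B ∧ c * A.card < B.card ∧ Set.InjOn N B ∧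
          ∀ b ∈ B, N b ⊆ A ∧ ∀ a ∈ N b, H.Adj b a ∧ col b a = q := by
  classical
  have := Fintype.ofFinite κ
  have hκ : 0 < Fintype.card κ := Fintype.card_pos
  -- The factor `Fintype.card κ` pays for pigeonholing colours: first among the edges at each `b`,
  -- then (in `c'`) among the vertices of `B`.
  set k := Fintype.card κ * (c + 4) with hk
  set c' := Fintype.card κ * (c + 1) with hc'
  refine ⟨4 * k * (c' + 1) + k, fun {W} _ H col hD => ?_⟩
  have := Fintype.ofFinite W
  obtain ⟨U, hU, hdeg⟩ := exists_subset_forall_le_degree H (4 * k * (c' + 1) + k) Finset.univ (by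
    have h1 := H.sum_degrees_eq_twice_card_edges
    simp only [← SimpleGraph.card_neighborFinset_eq_degree,
      SimpleGraph.neighborFinset_eq_filter] at h1
    rw [h1, Finset.card_univ, ← Nat.card_eq_fintype_card, mul_assoc]
    rw [Set.ncard_eq_toFinset_card'] at hD
    exact Nat.mul_lt_mul_of_pos_left hD two_pos)
  obtain ⟨A, B, hA, hAB, hcard, hB⟩ :=
    exists_small_set_many_neighbors H k c' (by positivity) U hU hdeg
  have hcol : ∀ b, ∃ q, b ∈ B →
      c + 4 ≤ ((A.filter (H.Adj b)).filter fun a => col b a = q).card := by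
    intro b
    by_cases hb : b ∈ B
    · obtain ⟨q, -, hq⟩ := Finset.exists_le_card_fiber_of_mul_le_card_of_maps_to
        (f := col b) (t := Finset.univ) (fun _ _ => Finset.mem_univ _) Finset.univ_nonempty (hB b hb)
      exact ⟨q, fun _ => hq⟩
    · exact ⟨Classical.arbitrary κ, fun h => absurd h hb⟩
  choose p hp using hcol
  obtain ⟨q, -, hq⟩ := Finset.exists_le_card_fiber_of_mul_le_card_of_maps_to (s := B) (f := p)
    (t := Finset.univ) (n := (c + 1) * A.card) (fun _ _ => Finset.mem_univ _)
    Finset.univ_nonempty (by rwa [Finset.card_univ, ← mul_assoc])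
  set T : W → Finset W := fun b => (A.filter (H.Adj b)).filter fun a => col b a = q with hT
  have hTA : ∀ b, T b ⊆ A := fun b => (Finset.filter_subset _ _).trans (Finset.filter_subset _ _)
  have hTadj : ∀ b, ∀ a ∈ T b, H.Adj b a ∧ col b a = q := fun b a ha => by
    simp only [hT, Finset.mem_filter] at ha
    exact ⟨ha.1.2, ha.2⟩
  have hBB : B.filter (fun b => p b = q) ⊆ B := Finset.filter_subset _ _
  rcases exists_injOn_subset_or_exists_shatter T (B.filter fun b => p b = q) with
    ⟨N, hinj, hN⟩ | ⟨b, hb, B', hB', N, hinj, hN, hcardB'⟩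
  · refine ⟨q, A, _, N, hA, hAB.mono_right hBB, lt_of_lt_of_le ?_ hq, hinj, fun b hb =>
      ⟨(hN b hb).trans (hTA b), fun a ha => hTadj b a (hN b hb ha)⟩⟩
    exact Nat.mul_lt_mul_of_pos_right (Nat.lt_succ_self c) hA.card_pos
  -- In the shattered case `T b` replaces `A`; its size `m ≥ c + 4` gives `c * m < 2 ^ m`.
  · rw [Finset.mem_filter] at hb
    have hTb : c + 4 ≤ (T b).card := by
      have h1 := hp b hb.1
      rwa [hb.2] at h1
    exact ⟨q, T b, B', N, Finset.card_pos.1 (by omega),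
      (hAB.mono_right (hB'.trans hBB)).mono_left (hTA b),
      (mul_lt_two_pow_of_add_four_le hTb).trans_le hcardB', hinj, fun b' hb' =>
        ⟨(hN b' hb').2, fun a ha => hTadj b' a ((hN b' hb').1 ha)⟩⟩

end Density

/-! ### Uniform choice of the formula and conclusion -/

/-- If every `q` failed at some `n q`, none would work at the maximum of these. This fixes the
colour, hence the formula, before the size. -/
theorem exists_forall_of_forall_exists_antitone {κ : Type*} [Finite κ] {P : κ → ℕ → Prop}
    (hP : ∀ q m n, m ≤ n → P q n → P q m) (h : ∀ n, ∃ q, P q n) : ∃ q, ∀ n, P q n := by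
  have := Fintype.ofFinite κ
  by_contra! hne
  choose n hn using hne
  obtain ⟨q, hq⟩ := h (Finset.univ.sup n)
  exact hn q (hP q _ _ (Finset.le_sup (Finset.mem_univ q)) hq)

/-- A relation on monochromatic edges of a shallow minor is encoded by walks of a fixed length in
some member of a subgraph-closed class. -/
theorem SubgraphClosed.exists_encoding {C : Set FiniteGraph.{u}} (hC : SubgraphClosed C)
    {G : FiniteGraph.{u}} (hG : G ∈ C) {W : Type v} {r : ℕ} {H : SimpleGraph W}
    (hH : IsDepthMinor r H G.graph) :
    ∃ col : W → W → Fin (r + 1) × Fin (r + 1), ∀ (q : Fin (r + 1) × Fin (r + 1)) (A B : Set W)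
      (F : W → W → Prop), Disjoint A B →
      (∀ b a, F b a → b ∈ B ∧ a ∈ A ∧ H.Adj b a ∧ col b a = q) →
      ∃ G' ∈ C, ∃ c : W → G'.V, c.Injective ∧ ∀ b ∈ B, ∀ a ∈ A,
        (HasWalk G'.graph (q.1 + 1 + q.2) (c b) (c a) ↔ F b a) := by
  obtain ⟨T⟩ := hH.nonempty_branchSystem
  obtain ⟨col, hcol⟩ := T.exists_color
  -- The colouring depends only on the minor, so `q`, `A`, `B` and `F` may be chosen after it.
  refine ⟨col, fun q A B F hAB hF => ?_⟩
  obtain ⟨G', hG', ⟨e⟩⟩ := hC.exists_iso_of_le hG (T.layered_le q.1 q.2 A B F)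
  refine ⟨G', hG', fun w => e (T.c w), e.injective.comp T.c_injective, fun b hb a ha => ?_⟩
  rw [HasWalk.iso_iff e]
  refine T.hasWalk_layered_iff hAB (fun b a h => ?_) hb ha
  obtain ⟨hb, ha, hadj, rfl⟩ := hF b a h
  exact ⟨hb, ha, hcol b a hadj⟩

theorem ncard_typeSet_walkFormula_of_shattered {V : Type*} {G : SimpleGraph V} {k n : ℕ}
    {f : Fin n → V} (hf : f.Injective)
    (hS : ∀ S : Set (Fin n), ∃ x, ∀ j, HasWalk G k x (f j) ↔ j ∈ S) :
    (Set.range f).ncard = n ∧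
      (typeSet (walkFormula k) G (Set.range f)).ncard = 2 ^ (Set.range f).ncard := by
  have hn : (Set.range f).ncard = n := by
    rw [Set.ncard_range_of_injective hf, Nat.card_eq_fintype_card, Fintype.card_fin]
  refine ⟨hn, ?_⟩
  have huniv : typeSet (walkFormula k) G (Set.range f) = Set.univ := by
    rw [typeSet_walkFormula]
    refine Set.eq_univ_of_forall fun T => ?_
    obtain ⟨x, hx⟩ := hS {j | (fun _ => ⟨f j, j, rfl⟩) ∈ T}
    refine ⟨x, Set.ext fun y => ?_⟩
    obtain ⟨j, hj⟩ := (y 0).2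
    have hy : y = fun _ => ⟨f j, j, rfl⟩ := by
      funext i
      rw [Subsingleton.elim i 0]
      exact Subtype.ext hj.symm
    rw [Set.mem_ofPred_eq, ← hj, hx j, Set.mem_ofPred_eq, ← hy]
  have := Fintype.ofFinite (Set.range f)
  rw [huniv, Set.ncard_univ, Nat.card_eq_fintype_card, Fintype.card_set, Fintype.card_fun,
    Fintype.card_fin, pow_one, ← Nat.card_eq_fintype_card, Nat.card_coe_set_eq]

theorem ncard_le_ncard_typeSet_walkFormula {V : Type*} [Finite V] {G : SimpleGraph V} {k : ℕ}
    {A B : Set V} (hAB : ∀ b ∈ B, ∀ b' ∈ B,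
      (∀ a ∈ A, HasWalk G k b a ↔ HasWalk G k b' a) → b = b') :
    B.ncard ≤ (typeSet (walkFormula k) G A).ncard := by
  rw [typeSet_walkFormula]
  refine Set.ncard_le_ncard_of_injOn (fun x => {y : Fin 1 → A | HasWalk G k x (y 0)})
    (fun x _ => Set.mem_range_self x) (fun b hb b' hb' h => hAB b hb b' hb' fun a ha => ?_)
    (Set.finite_range _)
  exact Set.ext_iff.1 h fun _ => ⟨a, ha⟩

theorem SubgraphClosed.exists_shattering_formula {C : Set FiniteGraph.{u}} (hC : SubgraphClosed C)
    (h : ¬ NowhereDense C) :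
    ∃ φ : Language.graph.Formula (Fin 1 ⊕ Fin 1), ∀ n : ℕ, ∃ G ∈ C, ∃ A : Set G.V,
      A.ncard = n ∧ (typeSet φ G.graph A).ncard = 2 ^ A.ncard := by
  obtain ⟨r, hr⟩ : ∃ r, ∀ t, ∃ G ∈ C, IsDepthMinor r (⊤ : SimpleGraph (Fin t)) G.graph := by
    by_contra! hne
    choose t ht using hne
    exact h ⟨t, ht⟩
  obtain ⟨q, hq⟩ : ∃ q : Fin (r + 1) × Fin (r + 1), ∀ n, ∃ G ∈ C, ∃ f : Fin n → G.V,
      f.Injective ∧ ∀ S : Set (Fin n), ∃ x, ∀ j,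
        HasWalk G.graph (q.1 + 1 + q.2) x (f j) ↔ j ∈ S := by
    refine exists_forall_of_forall_exists_antitone ?_ fun n => ?_
    · rintro q m n hmn ⟨G, hG, f, hf, hS⟩
      refine ⟨G, hG, f ∘ Fin.castLE hmn, hf.comp (Fin.castLE_injective hmn), fun S => ?_⟩
      obtain ⟨x, hx⟩ := hS (Fin.castLE hmn '' S)
      exact ⟨x, fun j => (hx _).trans (Fin.castLE_injective hmn).mem_set_image⟩
    · obtain ⟨t, ht⟩ := exists_monochromatic_product (Fin (r + 1) × Fin (r + 1)) n
      obtain ⟨G, hG, hminor⟩ := hr t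
      obtain ⟨col, hcol⟩ := hC.exists_encoding hG hminor
      obtain ⟨q, f, g, hf, hg, hfg, hq⟩ := ht col
      obtain ⟨G', hG', c, hc, hwalk⟩ := hcol q (Set.range f) (Set.range g)
        (fun b a => ∃ S, ∃ j ∈ S, b = g S ∧ a = f j)
        (by
          rw [Set.disjoint_left]
          rintro _ ⟨j, rfl⟩ ⟨S, hS⟩
          exact hfg j S hS.symm)
        (by
          rintro _ _ ⟨S, j, -, rfl, rfl⟩
          exact ⟨⟨S, rfl⟩, ⟨j, rfl⟩, (hfg j S).symm, hq j S⟩)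
      refine ⟨q, G', hG', c ∘ f, hc.comp hf, fun S => ⟨c (g S), fun j => ?_⟩⟩
      refine (hwalk _ ⟨S, rfl⟩ _ ⟨j, rfl⟩).trans ⟨?_, fun hj => ⟨S, j, hj, rfl, rfl⟩⟩
      rintro ⟨S', j', hj', hS, hj⟩
      rwa [hg hS, hf hj]
  refine ⟨walkFormula (q.1 + 1 + q.2), fun n => ?_⟩
  obtain ⟨G, hG, f, hf, hS⟩ := hq n
  exact ⟨G, hG, Set.range f, ncard_typeSet_walkFormula_of_shattered hf hS⟩

theorem SubgraphClosed.exists_formula_superlinear {C : Set FiniteGraph.{u}}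
    (hC : SubgraphClosed C) (h : ¬ BoundedExpansion C) :
    ∃ φ : Language.graph.Formula (Fin 1 ⊕ Fin 1), ∀ c : ℝ, ∃ G ∈ C, ∃ A : Set G.V,
      A.Nonempty ∧ c * (A.ncard : ℝ) < ((typeSet φ G.graph A).ncard : ℝ) := by
  obtain ⟨r, hr⟩ : ∃ r, ∀ D : ℕ, ∃ G ∈ C, ∃ H : FiniteGraph.{u},
      IsDepthMinor r H.graph G.graph ∧ (D : ℝ) < H.edgeDensity := by
    by_contra! hne
    choose d hd using hne
    exact h ⟨d, hd⟩
  obtain ⟨q, hq⟩ : ∃ q : Fin (r + 1) × Fin (r + 1), ∀ n : ℕ, ∃ G ∈ C, ∃ A : Set G.V,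
      A.Nonempty ∧ n * A.ncard <
        (typeSet (walkFormula (q.1 + 1 + q.2)) G.graph A).ncard := by
    refine exists_forall_of_forall_exists_antitone ?_ fun n => ?_
    · rintro q m n hmn ⟨G, hG, A, hA, hcard⟩
      exact ⟨G, hG, A, hA, (Nat.mul_le_mul_right _ hmn).trans_lt hcard⟩
    · obtain ⟨D, hD⟩ :=
        exists_monochromatic_distinct_neighborhoods.{u} (Fin (r + 1) × Fin (r + 1)) n
      obtain ⟨G, hG, H, hminor, hdens⟩ := hr D
      obtain ⟨col, hcol⟩ := hC.exists_encoding hG hminor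
      have := H.finite
      have hedges : D * Nat.card H.V < H.graph.edgeSet.ncard := by
        rw [FiniteGraph.edgeDensity] at hdens
        rcases Nat.eq_zero_or_pos (Nat.card H.V) with h0 | h0
        · rw [h0, Nat.cast_zero, div_zero] at hdens
          exact absurd hdens (not_lt.2 (Nat.cast_nonneg D))
        · rw [lt_div_iff₀ (by exact_mod_cast h0)] at hdens
          exact_mod_cast hdens
      obtain ⟨q, A, B, N, hA, hAB, hcard, hinj, hN⟩ := hD H.graph col hedges
      obtain ⟨G', hG', c, hc, hwalk⟩ := hcol q A B (fun b a => b ∈ B ∧ a ∈ N b)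
        (Finset.disjoint_coe.2 hAB)
        (fun b a hba => ⟨hba.1, (hN b hba.1).1 hba.2, (hN b hba.1).2 a hba.2⟩)
      have := G'.finite
      refine ⟨q, G', hG', c '' A, (Finset.coe_nonempty.2 hA).image c, ?_⟩
      rw [Set.ncard_image_of_injective _ hc, Set.ncard_coe_finset]
      refine hcard.trans_le ?_
      rw [← Set.ncard_coe_finset B, ← Set.ncard_image_of_injective (B : Set H.V) hc]
      refine ncard_le_ncard_typeSet_walkFormula ?_
      rintro _ ⟨b, hb, rfl⟩ _ ⟨b', hb', rfl⟩ hbb'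
      have hsub : N b = N b' := by
        ext a
        by_cases ha : a ∈ A
        · have h1 := hbb' (c a) ⟨a, ha, rfl⟩
          rw [hwalk b hb a ha, hwalk b' hb' a ha] at h1
          exact ⟨fun h => (h1.1 ⟨hb, h⟩).2, fun h => (h1.2 ⟨hb', h⟩).2⟩
        · exact ⟨fun h => absurd ((hN b hb).1 h) ha, fun h => absurd ((hN b' hb').1 h) ha⟩
      rw [hinj hb hb' hsub]
  refine ⟨walkFormula (q.1 + 1 + q.2), fun c => ?_⟩
  obtain ⟨n, hn⟩ := exists_nat_ge c
  obtain ⟨G, hG, A, hA, hcard⟩ := hq n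
  refine ⟨G, hG, A, hA, (mul_le_mul_of_nonneg_right hn (Nat.cast_nonneg _)).trans_lt ?_⟩
  exact_mod_cast hcard

end SparseGraphs

theorem mainTheorem5 (C : Set SparseGraphs.FiniteGraph.{u})
    (hC : SparseGraphs.SubgraphClosed C) :
    (¬ SparseGraphs.NowhereDense C →
      ∃ φ : Language.graph.Formula (Fin 1 ⊕ Fin 1), ∀ n : ℕ, ∃ G ∈ C, ∃ A : Set G.V,
        A.ncard = n ∧ (SparseGraphs.typeSet φ G.graph A).ncard = 2 ^ A.ncard) ∧
    (¬ SparseGraphs.BoundedExpansion C →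
      ∃ φ : Language.graph.Formula (Fin 1 ⊕ Fin 1), ∀ c : ℝ, ∃ G ∈ C, ∃ A : Set G.V,
        A.Nonempty ∧ c * (A.ncard : ℝ) < ((SparseGraphs.typeSet φ G.graph A).ncard : ℝ)) := by
  exact ⟨hC.exists_shattering_formula, hC.exists_formula_superlinear⟩
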